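/- Let $\mathbf{x} = a_0 a_1 a_2 \cdots$ be an infinite word over a finite alphabet. For $n \ge 0$ let $\rho_{\mathbf{x}}(n)$ be the number of distinct factors (blocks of consecutive letters) of length $n$ of $\mathbf{x}$. Let $E_{\mathbf{x}}(n)$ be the set of all positions $i \ge 0$ such that the occurrence $a_i a_{i+1} \cdots a_{i+n-1}$ is novel, i.e. such that $a_j a_{j+1} \cdots a_{j+n-1} \ne a_i a_{i+1} \cdots a_{i+n-1}$ for every $0 \le j < i$. A contiguous block of a set $S \subseteq \mathbb{N}$ is a maximal nonempty interval of consecutive integers contained in $S$. If $\rho_{\mathbf{x}}(n) = O(n)$ as $n \to \infty$, then there is a constant $C$ (which may depend on $\mathbf{x}$ but not on $n$) such that for every $n \ge 0$ the set $E_{\mathbf{x}}(n)$ consists of at most $C$ contiguous blocks. -/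

import Mathlib

namespace InfiniteWord

/-- The factor of length `n` of the infinite word `x` that begins at position `i`. -/
def factor {A : Type*} (x : ℕ → A) (n i : ℕ) : Fin n → A :=
  fun m => x (i + m)

/-- The subword complexity: the number of distinct factors of length `n` of `x`
(there are finitely many of them when the alphabet is finite). -/
noncomputable def subwordComplexity {A : Type*} (x : ℕ → A) (n : ℕ) : ℕ :=
  (Set.range (factor x n)).ncard

/-- The occurrence at position `i` of a factor of length `n` is novel if the same word
does not occur at any earlier position. -/
def IsNovel {A : Type*} (x : ℕ → A) (n i : ℕ) : Prop :=
  ∀ j < i, factor x n j ≠ factor x n i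

/-- The set of the starting positions of the novel occurrences of factors of length `n`. -/
def novelSet {A : Type*} (x : ℕ → A) (n : ℕ) : Set ℕ :=
  {i | IsNovel x n i}

/-- The contiguous blocks of a set `S` of natural numbers: the maximal nonempty intervals
of consecutive integers contained in `S`. -/
def contiguousBlocks (S : Set ℕ) : Set (Set ℕ) :=
  {B | Maximal (fun I : Set ℕ => I.Nonempty ∧ I.OrdConnected ∧ I ⊆ S) B}

end InfiniteWord

/-!
Every block of `novelSet x n` except the one containing `0` begins at a position `i` that is novel
while `i - 1` is not. The earlier occurrence of the factor at `i - 1`, shifted by one, shows that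
the factor of length `n - 1` at `i` is right special: it occurs in `x` followed by two different
letters. As distinct novel positions carry distinct factors, the number of blocks is at most
`1 + |A| * R (n - 1)`, where `R k` is the number of right special factors of length `k`
(`encard_blockStarts_le`). It remains to see that `R` is bounded when the complexity is linear
(`exists_rightSpecial_ncard_le`), a form of Cassaigne's theorem on the first difference of the
complexity function.

Since `R k ≤ ρ (k + 1) - ρ k`, averaging over an interval of lengths slightly below `n` gives a
length `m` in it with `R m` bounded. Let `w` be right special of length `n` and `z` its suffix of
length `m`. If `z` recurs soon after an occurrence, at distance `d`, then `d` is a period of `z`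
and the letter following `z` continues this period; two small periods of `z` agree on that letter.
As `w` has occurrences followed by different letters, one of them is therefore *isolated*: its `z`
does not recur soon (`isolated_or_isolated`). The isolated occurrences of one `z` are far apart and
there are boundedly many `z`, so a window of length `n` contains boundedly many isolated
occurrences of right special words (`ncard_isolated_window_le`). On the other hand, the words of
length `3 * n` read at `n` successive shifts around one isolated occurrence of each right special
word of length `n` are only `O(n)` in number, and each arises boundedly often; hence `R n` is
bounded.
-/

namespace InfiniteWord

variable {A : Type*}

/-! ### Factors and complexity -/

lemma factor_eq_iff {x : ℕ → A} {n i j : ℕ} :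
    factor x n i = factor x n j ↔ ∀ k < n, x (i + k) = x (j + k) := by
  constructor
  · intro h k hk
    exact congrFun h ⟨k, hk⟩
  · intro h
    funext k
    exact h k k.2

lemma factor_eq_sub {x : ℕ → A} {n i j : ℕ} (h : factor x n i = factor x n j) {s m : ℕ}
    (hm : s + m ≤ n) : factor x m (i + s) = factor x m (j + s) := by
  rw [factor_eq_iff] at h ⊢
  intro k hk
  have := h (s + k) (by omega)
  simpa [add_assoc] using this

lemma factor_eq_prefix {x : ℕ → A} {n i j : ℕ} (h : factor x n i = factor x n j) {m : ℕ}
    (hm : m ≤ n) : factor x m i = factor x m j :=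
  factor_eq_sub (s := 0) h (by omega)

lemma factor_succ_eq {x : ℕ → A} {n i j : ℕ} (h : factor x n i = factor x n j)
    (h' : x (i + n) = x (j + n)) : factor x (n + 1) i = factor x (n + 1) j := by
  rw [factor_eq_iff] at h ⊢
  intro k hk
  rcases Nat.lt_succ_iff_lt_or_eq.1 hk with hk | rfl
  · exact h k hk
  · exact h'

/-- The factors of length `n` of `x` that occur in `x` followed by two different letters. -/
def rightSpecial (x : ℕ → A) (n : ℕ) : Set (Fin n → A) :=
  {w | ∃ i j, factor x n i = w ∧ factor x n j = w ∧ x (i + n) ≠ x (j + n)}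

lemma rightSpecial_subset_range (x : ℕ → A) (n : ℕ) :
    rightSpecial x n ⊆ Set.range (factor x n) := by
  rintro w ⟨i, -, hi, -, -⟩
  exact ⟨i, hi⟩

/-- A suffix of a right special factor is right special. -/
lemma factor_suffix_mem_rightSpecial {x : ℕ → A} {m r p : ℕ}
    (h : factor x (r + m) p ∈ rightSpecial x (r + m)) :
    factor x m (p + r) ∈ rightSpecial x m := by
  obtain ⟨i, j, hi, hj, hij⟩ := h
  exact ⟨i + r, j + r, factor_eq_sub hi le_rfl, factor_eq_sub hj le_rfl,
    by simpa [add_assoc] using hij⟩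

/-- Each factor has an extension by one letter, and each right special factor a second one. -/
lemma complexity_add_rightSpecial_le [Finite A] (x : ℕ → A) (n : ℕ) :
    subwordComplexity x n + (rightSpecial x n).ncard ≤ subwordComplexity x (n + 1) := by
  classical
  have hc : ∀ w : Fin n → A, ∃ i, w ∈ Set.range (factor x n) → factor x n i = w := by
    intro w
    by_cases hw : w ∈ Set.range (factor x n)
    · exact ⟨hw.choose, fun _ => hw.choose_spec⟩
    · exact ⟨0, fun h => absurd h hw⟩
  choose c hc using hc
  set E : Set (Fin (n + 1) → A) :=
    (fun w => factor x (n + 1) (c w)) '' Set.range (factor x n) with hE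
  have hER : E ⊆ Set.range (factor x (n + 1)) := by
    rintro _ ⟨w, -, rfl⟩
    exact ⟨c w, rfl⟩
  have hEcard : E.ncard = subwordComplexity x n := by
    refine Set.InjOn.ncard_image ?_
    intro w hw w' hw' h
    rw [← hc w hw, ← hc w' hw']
    exact factor_eq_prefix h (Nat.le_succ n)
  have hsub : rightSpecial x n ⊆
      (fun v : Fin (n + 1) → A => fun k : Fin n => v k.castSucc) ''
        (Set.range (factor x (n + 1)) \ E) := by
    intro w hw
    have hcw := hc w (rightSpecial_subset_range x n hw)
    obtain ⟨i, j, hi, hj, hij⟩ := hw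
    -- one of the two occurrences is not followed by the letter chosen by `c`
    obtain ⟨k, hk, hkc⟩ : ∃ k, factor x n k = w ∧ x (k + n) ≠ x (c w + n) := by
      by_cases h : x (i + n) = x (c w + n)
      · exact ⟨j, hj, fun h' => hij (h.trans h'.symm)⟩
      · exact ⟨i, hi, h⟩
    refine ⟨factor x (n + 1) k, ⟨⟨k, rfl⟩, ?_⟩, hk⟩
    rintro ⟨w', hw', h⟩
    have h1 : w' = w := by
      rw [← hc w' hw', ← hk]
      exact factor_eq_prefix h (Nat.le_succ n)
    subst h1
    exact hkc ((factor_eq_iff.1 h n (Nat.lt_succ_self n)).symm)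
  have h1 : (rightSpecial x n).ncard ≤ (Set.range (factor x (n + 1)) \ E).ncard :=
    (Set.ncard_le_ncard hsub (Set.toFinite _)).trans (Set.ncard_image_le (Set.toFinite _))
  have h2 := Set.ncard_sdiff_add_ncard_of_subset hER (Set.toFinite _)
  unfold subwordComplexity at hEcard ⊢
  omega

lemma mul_le_complexity [Finite A] (x : ℕ → A) (h b q : ℕ)
    (hb : ∀ m, h ≤ m → m < h + q → b ≤ (rightSpecial x m).ncard) :
    q * b ≤ subwordComplexity x (h + q) := by
  induction q with
  | zero => simp
  | succ q ih =>
    have h1 := ih fun m hm hm' => hb m hm (by omega)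
    have h2 := hb (h + q) (by omega) (by omega)
    have h3 := complexity_add_rightSpecial_le x (h + q)
    rw [← add_assoc, add_mul, one_mul]
    omega

lemma exists_complexity_le (x : ℕ → A)
    (hx : (fun n : ℕ => (subwordComplexity x n : ℝ)) =O[Filter.atTop] (fun n : ℕ => (n : ℝ))) :
    ∃ K, ∀ n, subwordComplexity x n ≤ K * (n + 1) := by
  obtain ⟨c, hc⟩ := hx.bound
  obtain ⟨N, hN⟩ := Filter.eventually_atTop.1 hc
  refine ⟨⌈c⌉₊ + ∑ k ∈ Finset.range N, subwordComplexity x k, fun n => ?_⟩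
  rcases lt_or_ge n N with h | h
  · have h1 : subwordComplexity x n ≤ ∑ k ∈ Finset.range N, subwordComplexity x k :=
      Finset.single_le_sum (f := fun k => subwordComplexity x k) (fun _ _ => Nat.zero_le _)
        (Finset.mem_range.2 h)
    nlinarith [Nat.zero_le ⌈c⌉₊]
  · have h1 := hN n h
    simp only [Real.norm_natCast] at h1
    have h2 : (subwordComplexity x n : ℝ) ≤ (⌈c⌉₊ * n : ℕ) := by
      push_cast
      exact h1.trans (mul_le_mul_of_nonneg_right (Nat.le_ceil c) (Nat.cast_nonneg n))
    have h3 : subwordComplexity x n ≤ ⌈c⌉₊ * n := by exact_mod_cast h2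
    exact h3.trans (Nat.mul_le_mul (Nat.le_add_right _ _) (Nat.le_succ n))

/-! ### Isolated occurrences -/

/-- The occurrence at `p` of a factor of length `m` is `q`-isolated if this factor does not recur
at a position in the open interval from `p` to `p + q`. -/
def Isolated (x : ℕ → A) (m q p : ℕ) : Prop :=
  ∀ d, 0 < d → d < q → factor x m (p + d) ≠ factor x m p

/-- Of two occurrences of a word that are followed by different letters, one is isolated.
Otherwise the word has two small periods `d` and `e`, one continued by each of the two letters;
but both letters are then equal to the letter `d + e` places before the end. -/
lemma isolated_or_isolated {x : ℕ → A} {m q i j : ℕ} (hq : 2 * q ≤ m)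
    (hij : factor x m i = factor x m j) (hne : x (i + m) ≠ x (j + m)) :
    Isolated x m q i ∨ Isolated x m q j := by
  by_contra! hcon
  simp only [Isolated, not_forall, not_not] at hcon
  obtain ⟨⟨d, hd0, hdq, hd⟩, e, he0, heq, he⟩ := hcon
  rw [factor_eq_iff] at hij hd he
  apply hne
  have a1 := hd (m - d) (by omega)
  have a2 := hd (m - d - e) (by omega)
  have b1 := he (m - e) (by omega)
  have b2 := he (m - d - e) (by omega)
  have c1 := hij (m - d) (by omega)
  have c2 := hij (m - e) (by omega)
  have c3 := hij (m - d - e) (by omega)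
  rw [show i + d + (m - d) = i + m by omega] at a1
  rw [show i + d + (m - d - e) = i + (m - e) by omega] at a2
  rw [show j + e + (m - e) = j + m by omega] at b1
  rw [show j + e + (m - d - e) = j + (m - d) by omega] at b2
  rw [a1, c1, b2, ← c3, ← a2, c2, b1]

/-- The positions of right special factors of length `r + m` whose suffix of length `m` is
`q`-isolated. -/
def isolatedPositions (x : ℕ → A) (r m q : ℕ) : Set ℕ :=
  {p | factor x (r + m) p ∈ rightSpecial x (r + m) ∧ Isolated x m q (p + r)}

/-- A window of length at most `t * q` is cut into `t` intervals of length `q`, and each of these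
contains at most one isolated occurrence of a given suffix. -/
lemma ncard_isolated_window_le [Finite A] (x : ℕ → A) {r m q t l : ℕ} (hl : l ≤ t * q) (y : ℕ) :
    (isolatedPositions x r m q ∩ Set.Ico y (y + l)).ncard ≤ (rightSpecial x m).ncard * t := by
  have hfin : (rightSpecial x m ×ˢ (Finset.range t : Set ℕ)).Finite :=
    (Set.toFinite _).prod (Finset.finite_toSet _)
  have hcard : (rightSpecial x m ×ˢ (Finset.range t : Set ℕ)).ncard
      = (rightSpecial x m).ncard * t := by
    rw [Set.ncard_prod, Set.ncard_coe_finset, Finset.card_range]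
  rw [← hcard]
  refine Set.ncard_le_ncard_of_injOn (fun p => (factor x m (p + r), (p - y) / q)) ?_ ?_ hfin
  · rintro p ⟨⟨hp, -⟩, hy, hl'⟩
    refine ⟨factor_suffix_mem_rightSpecial hp, ?_⟩
    simp only [Finset.coe_range, Set.mem_Iio]
    exact Nat.div_lt_of_lt_mul (by rw [mul_comm]; omega)
  · have key : ∀ p ∈ isolatedPositions x r m q ∩ Set.Ico y (y + l),
        ∀ p' ∈ isolatedPositions x r m q ∩ Set.Ico y (y + l),
        factor x m (p + r) = factor x m (p' + r) → (p - y) / q = (p' - y) / q → ¬ p < p' := by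
      rintro p ⟨⟨-, hiso⟩, hy, hpl⟩ p' ⟨-, hy', -⟩ hf hdiv hlt
      have hq : 0 < q := by
        rcases Nat.eq_zero_or_pos q with h | h
        · subst h
          omega
        · exact h
      refine hiso (p' - p) (by omega) ?_ ?_
      · have h1 := Nat.div_add_mod (p - y) q
        have h2 := Nat.div_add_mod (p' - y) q
        have h3 := Nat.mod_lt (p' - y) hq
        rw [hdiv] at h1
        omega
      · rw [show p + r + (p' - p) = p' + r by omega]
        exact hf.symm
    intro p hp p' hp' h
    simp only [Prod.mk.injEq] at h
    rcases lt_trichotomy p p' with hlt | heq | hgt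
    · exact absurd hlt (key p hp p' hp' h.1 h.2)
    · exact heq
    · exact absurd hgt (key p' hp' p hp h.1.symm h.2.symm)

/-- Being an isolated position depends only on a window around the position, provided the window
shows that the word is right special and reaches far enough to exclude a recurrence. -/
lemma isolatedPositions_of_factor_eq {x : ℕ → A} {r m q p p' : ℕ}
    (hp : p ∈ isolatedPositions x r m q)
    (h : factor x (r + m + q) p' = factor x (r + m + q) p) :
    p' ∈ isolatedPositions x r m q := by
  refine ⟨?_, fun d hd hdq he => hp.2 d hd hdq ?_⟩
  · rw [factor_eq_prefix h (Nat.le_add_right _ _)]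
    exact hp.1
  · have h1 : factor x m (p' + r) = factor x m (p + r) := factor_eq_sub h (by omega)
    have h2 : factor x m (p' + (r + d)) = factor x m (p + (r + d)) := factor_eq_sub h (by omega)
    rw [← add_assoc, ← add_assoc] at h2
    rw [← h1, ← h2, he]

/-! ### Boundedness of the number of right special factors -/

/-- Let `n = r + m`. If windows of length `n` contain at most `B` isolated positions, then each
word of length `3 * n` is read at most `B` times when windows of this length are placed in `n`
successive shifts around one isolated occurrence of each right special word of length `n`. The words whose chosen occurrence lies in the initial segment of
length `n`, where the windows would not fit, are counted separately by the summand `B`. -/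
lemma ncard_rightSpecial_mul_le [Finite A] (x : ℕ → A) {r m q B : ℕ} (hqm : 2 * q ≤ m)
    (hB : ∀ y, (isolatedPositions x r m q ∩ Set.Ico y (y + (r + m))).ncard ≤ B) :
    (rightSpecial x (r + m)).ncard * (r + m)
      ≤ B * (r + m) + B * subwordComplexity x (3 * (r + m)) := by
  classical
  set n := r + m with hn
  have hex : ∀ w : Fin n → A, ∃ p, w ∈ rightSpecial x n →
      factor x n p = w ∧ p ∈ isolatedPositions x r m q := by
    intro w
    by_cases hw : w ∈ rightSpecial x n
    · obtain ⟨i, j, hi, hj, hij⟩ := id hw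
      have hs : factor x m (i + r) = factor x m (j + r) :=
        factor_eq_sub (hi.trans hj.symm) le_rfl
      rcases isolated_or_isolated hqm hs (by simpa [add_assoc, ← hn] using hij) with h | h
      · exact ⟨i, fun _ => ⟨hi, by rw [← hn, hi]; exact hw, h⟩⟩
      · exact ⟨j, fun _ => ⟨hj, by rw [← hn, hj]; exact hw, h⟩⟩
    · exact ⟨0, fun h => absurd h hw⟩
  choose p hp using hex
  have hpinj : ∀ w ∈ rightSpecial x n, ∀ w' ∈ rightSpecial x n, p w = p w' → w = w' := by
    intro w hw w' hw' h
    rw [← (hp w hw).1, ← (hp w' hw').1, h]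
  set R : Finset (Fin n → A) := (Set.toFinite (rightSpecial x n)).toFinset with hR
  have hmem : ∀ w, w ∈ R ↔ w ∈ rightSpecial x n := fun w => Set.Finite.mem_toFinset _
  have hRcard : (rightSpecial x n).ncard = R.card :=
    Set.ncard_eq_toFinset_card _ _
  set T := R.filter fun w => n ≤ p w with hT
  set T' := R.filter fun w => ¬ n ≤ p w with hT'
  have hsplit : T.card + T'.card = R.card := Finset.card_filter_add_card_filter_not _
  have hwin : ∀ y, (isolatedPositions x r m q ∩ Set.Ico y (y + n)).Finite :=
    fun y => (Set.finite_Ico _ _).subset Set.inter_subset_right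
  have hT'card : T'.card ≤ B := by
    refine le_trans ?_ (hB 0)
    rw [← Set.ncard_coe_finset]
    refine Set.ncard_le_ncard_of_injOn p ?_ ?_ (hwin 0)
    · intro w hw
      have hw := Finset.mem_filter.1 (Finset.mem_coe.1 hw)
      exact ⟨(hp w ((hmem w).1 hw.1)).2, Nat.zero_le _, by omega⟩
    · intro w hw w' hw' h
      have hw := Finset.mem_filter.1 (Finset.mem_coe.1 hw)
      have hw' := Finset.mem_filter.1 (Finset.mem_coe.1 hw')
      exact hpinj w ((hmem w).1 hw.1) w' ((hmem w').1 hw'.1) h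
  have hTcard : T.card * n ≤ B * subwordComplexity x (3 * n) := by
    set f : (Fin n → A) × ℕ → (Fin (3 * n) → A) := fun a => factor x (3 * n) (p a.1 - a.2) with hf
    have h1 : (T ×ˢ Finset.range n).card ≤ B * ((T ×ˢ Finset.range n).image f).card := by
      refine Finset.card_le_mul_card_image _ _ ?_
      intro v hv
      obtain ⟨⟨w₀, i₀⟩, -, rfl⟩ := Finset.mem_image.1 hv
      set y := p w₀ - i₀ with hy
      -- transport each isolated occurrence of the fibre into the window that starts at `y`
      have htr : ∀ a ∈ (T ×ˢ Finset.range n).filter (fun a => f a = f (w₀, i₀)),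
          a.1 ∈ rightSpecial x n ∧ a.2 < n ∧
            factor x (r + m + q) (y + a.2) = factor x (r + m + q) (p a.1) := by
        rintro ⟨w, i⟩ ha
        obtain ⟨ha, hfa⟩ := Finset.mem_filter.1 ha
        obtain ⟨hw, hi⟩ := Finset.mem_product.1 ha
        obtain ⟨hw, hnp⟩ := Finset.mem_filter.1 hw
        have hi := Finset.mem_range.1 hi
        simp only at hw hi hnp ⊢
        refine ⟨(hmem w).1 hw, hi, ?_⟩
        have := factor_eq_sub (x := x) (s := i) (m := r + m + q) hfa.symm (by omega)
        simp only at this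
        rwa [show p w - i + i = p w by omega] at this
      refine le_trans ?_ (hB y)
      rw [← Set.ncard_coe_finset]
      refine Set.ncard_le_ncard_of_injOn (fun a => y + a.2) ?_ ?_ (hwin y)
      · intro a ha
        obtain ⟨hw, hi, he⟩ := htr a (Finset.mem_coe.1 ha)
        exact ⟨isolatedPositions_of_factor_eq (hp _ hw).2 he, Nat.le_add_right _ _,
          Nat.add_lt_add_left hi y⟩
      · intro a ha a' ha' h
        obtain ⟨hw, hi, he⟩ := htr a (Finset.mem_coe.1 ha)
        obtain ⟨hw', hi', he'⟩ := htr a' (Finset.mem_coe.1 ha')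
        have h2 : a.2 = a'.2 := Nat.add_left_cancel h
        refine Prod.ext ?_ h2
        rw [← (hp _ hw).1, ← (hp _ hw').1]
        rw [h2] at he
        exact factor_eq_prefix (he.symm.trans he') (Nat.le_add_right _ _)
    have h2 : ((T ×ˢ Finset.range n).image f).card ≤ subwordComplexity x (3 * n) := by
      rw [← Set.ncard_coe_finset]
      refine Set.ncard_le_ncard ?_ (Set.toFinite _)
      intro v hv
      obtain ⟨a, -, rfl⟩ := Finset.mem_image.1 (Finset.mem_coe.1 hv)
      exact ⟨_, rfl⟩
    rw [Finset.card_product, Finset.card_range] at h1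
    exact h1.trans (Nat.mul_le_mul_left B h2)
  rw [hRcard, ← hsplit, add_mul, add_comm]
  exact Nat.add_le_add (Nat.mul_le_mul_right n hT'card) hTcard

lemma exists_rightSpecial_ncard_le [Finite A] (x : ℕ → A) {K : ℕ}
    (hK : ∀ n, subwordComplexity x n ≤ K * (n + 1)) :
    ∃ C, ∀ n, (rightSpecial x n).ncard ≤ C := by
  refine ⟨32 * K * 32 * (1 + 4 * K) + 16 * K, fun n => ?_⟩
  rcases lt_or_ge n 16 with hn | hn
  · have h1 : (rightSpecial x n).ncard ≤ subwordComplexity x n :=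
      Set.ncard_le_ncard (rightSpecial_subset_range x n) (Set.toFinite _)
    have h2 : K * (n + 1) ≤ K * 16 := Nat.mul_le_mul_left K (by omega)
    have h3 := hK n
    omega
  -- `q` is of the order of `n`, and `m` lies in the interval from `n - q` to `n`
  · set q := n / 16 with hq
    have hq1 : 1 ≤ q := by omega
    obtain ⟨m, hm1, hm2, hm⟩ : ∃ m, n - q ≤ m ∧ m < n - q + q ∧
        (rightSpecial x m).ncard ≤ 32 * K := by
      by_contra! hcon
      have h1 := mul_le_complexity x (n - q) (32 * K + 1) q fun m h h' => hcon m h h'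
      rw [show n - q + q = n by omega] at h1
      have h2 := hK n
      have h3 : K * (n + 1) ≤ K * (32 * q) := Nat.mul_le_mul_left K (by omega)
      nlinarith
    obtain ⟨r, rfl⟩ : ∃ r, n = r + m := ⟨n - m, by omega⟩
    have hB : ∀ y, (isolatedPositions x r m q ∩ Set.Ico y (y + (r + m))).ncard
        ≤ 32 * K * 32 := fun y =>
      (ncard_isolated_window_le x (t := 32) (by omega) y).trans (Nat.mul_le_mul_right 32 hm)
    have h1 := ncard_rightSpecial_mul_le x (by omega) hB
    have h2 : subwordComplexity x (3 * (r + m)) ≤ 4 * K * (r + m) := by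
      refine (hK _).trans ?_
      calc K * (3 * (r + m) + 1) ≤ K * (4 * (r + m)) := Nat.mul_le_mul_left K (by omega)
        _ = 4 * K * (r + m) := by ring
    have h3 : (rightSpecial x (r + m)).ncard * (r + m)
        ≤ 32 * K * 32 * (1 + 4 * K) * (r + m) := by
      refine h1.trans ?_
      calc 32 * K * 32 * (r + m) + 32 * K * 32 * subwordComplexity x (3 * (r + m))
          ≤ 32 * K * 32 * (r + m) + 32 * K * 32 * (4 * K * (r + m)) :=
            Nat.add_le_add_left (Nat.mul_le_mul_left _ h2) _
        _ = 32 * K * 32 * (1 + 4 * K) * (r + m) := by ring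
    have h4 := Nat.le_of_mul_le_mul_right h3 (by omega)
    omega

/-! ### Contiguous blocks -/

/-- The elements of `S` at which a contiguous block of `S` begins. -/
def blockStarts (S : Set ℕ) : Set ℕ :=
  {i | i ∈ S ∧ ∀ j, j + 1 = i → j ∉ S}

lemma contiguousBlocks_eq_of_mem {S B B' : Set ℕ} (hB : B ∈ contiguousBlocks S)
    (hB' : B' ∈ contiguousBlocks S) {i : ℕ} (hi : i ∈ B) (hi' : i ∈ B') : B = B' := by
  simp only [contiguousBlocks, Set.mem_ofPred_eq] at hB hB'
  have hU : (B ∪ B').Nonempty ∧ (B ∪ B').OrdConnected ∧ B ∪ B' ⊆ S := by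
    refine ⟨⟨i, Or.inl hi⟩, ⟨?_⟩, Set.union_subset hB.prop.2.2 hB'.prop.2.2⟩
    intro a ha b hb c hc
    rcases le_total c i with h | h
    · exact ha.imp (fun ha => hB.prop.2.1.out ha hi ⟨hc.1, h⟩)
        fun ha => hB'.prop.2.1.out ha hi' ⟨hc.1, h⟩
    · exact hb.imp (fun hb => hB.prop.2.1.out hi hb ⟨h, hc.2⟩)
        fun hb => hB'.prop.2.1.out hi' hb ⟨h, hc.2⟩
  exact (hB.eq_of_le hU Set.subset_union_left).trans
    (hB'.eq_of_le hU Set.subset_union_right).symm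

lemma encard_contiguousBlocks_le (S : Set ℕ) :
    (contiguousBlocks S).encard ≤ (blockStarts S).encard := by
  refine Set.encard_le_encard_of_injOn (f := sInf) ?_ ?_
  · intro B hB
    simp only [contiguousBlocks, Set.mem_ofPred_eq] at hB
    have hmin : sInf B ∈ B := Nat.sInf_mem hB.prop.1
    refine ⟨hB.prop.2.2 hmin, fun j hj hjS => ?_⟩
    -- otherwise the block could be prolonged to the left by `j`
    have hI : (insert j B).Nonempty ∧ (insert j B).OrdConnected ∧ insert j B ⊆ S := by
      refine ⟨⟨j, Set.mem_insert _ _⟩, ⟨?_⟩, Set.insert_subset hjS hB.prop.2.2⟩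
      intro a ha b hb c hc
      have hja : j ≤ a := by
        rcases ha with rfl | ha
        · exact le_rfl
        · have := Nat.sInf_le ha
          omega
      rcases eq_or_lt_of_le (hja.trans hc.1) with h | h
      · exact Or.inl h.symm
      · rcases hb with rfl | hb
        · exact absurd hc.2 (by omega)
        · exact Or.inr (hB.prop.2.1.out hmin hb ⟨by omega, hc.2⟩)
    have hjB : j ∈ B := hB.le_of_ge hI (Set.subset_insert _ _) (Set.mem_insert _ _)
    have := Nat.sInf_le hjB
    omega
  · intro B hB B' hB' h
    have h1 : sInf B ∈ B := Nat.sInf_mem (Maximal.prop hB.out).1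
    have h2 : sInf B ∈ B' := h ▸ Nat.sInf_mem (Maximal.prop hB'.out).1
    exact contiguousBlocks_eq_of_mem hB hB' h1 h2

lemma novelSet_injOn (x : ℕ → A) (n : ℕ) : Set.InjOn (factor x n) (novelSet x n) := by
  intro i hi j hj h
  rcases lt_trichotomy i j with hlt | heq | hgt
  · exact absurd h (hj i hlt)
  · exact heq
  · exact absurd h.symm (hi j hgt)

lemma factor_mem_rightSpecial_of_blockStart {x : ℕ → A} {n i : ℕ}
    (hi : i + 1 ∈ blockStarts (novelSet x (n + 1))) :
    factor x n (i + 1) ∈ rightSpecial x n := by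
  have hnot := hi.2 i rfl
  simp only [novelSet, IsNovel, Set.mem_ofPred_eq, not_forall, not_not] at hnot
  obtain ⟨j, hj, he⟩ := hnot
  have h1 : factor x n (j + 1) = factor x n (i + 1) := factor_eq_sub he (by omega)
  refine ⟨i + 1, j + 1, rfl, h1, fun h => ?_⟩
  exact hi.1 (j + 1) (by omega) (factor_succ_eq h1 h.symm)

lemma encard_blockStarts_le [Finite A] (x : ℕ → A) (n : ℕ) :
    (blockStarts (novelSet x (n + 1))).encard
      ≤ (((rightSpecial x n).ncard * Nat.card A + 1 : ℕ) : ℕ∞) := by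
  set S := blockStarts (novelSet x (n + 1)) with hS
  have h1 : (S \ {0}).encard ≤ (rightSpecial x n ×ˢ (Set.univ : Set A)).encard := by
    refine Set.encard_le_encard_of_injOn (f := fun i => (factor x n i, x (i + n))) ?_ ?_
    · rintro i ⟨hi, hi0⟩
      obtain ⟨k, rfl⟩ := Nat.exists_eq_succ_of_ne_zero hi0
      exact ⟨factor_mem_rightSpecial_of_blockStart hi, Set.mem_univ _⟩
    · rintro i ⟨hi, -⟩ j ⟨hj, -⟩ h
      simp only [Prod.mk.injEq] at h
      exact novelSet_injOn x (n + 1) hi.1 hj.1 (factor_succ_eq h.1 h.2)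
  have h2 : (rightSpecial x n ×ˢ (Set.univ : Set A)).encard
      = (((rightSpecial x n).ncard * Nat.card A : ℕ) : ℕ∞) := by
    rw [← (Set.toFinite _).cast_ncard_eq, Set.ncard_prod, Set.ncard_univ]
  calc S.encard ≤ (S \ {0}).encard + ({0} : Set ℕ).encard := by
        rw [← Set.encard_sdiff_add_encard_inter S {0}]
        exact add_le_add le_rfl (Set.encard_le_encard Set.inter_subset_right)
    _ ≤ (((rightSpecial x n).ncard * Nat.card A + 1 : ℕ) : ℕ∞) := by
        rw [Set.encard_singleton, Nat.cast_add, Nat.cast_one, ← h2]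
        exact add_le_add h1 le_rfl

lemma blockStarts_novelSet_zero_subset (x : ℕ → A) : blockStarts (novelSet x 0) ⊆ {0} := by
  rintro i ⟨hi, -⟩
  by_contra h0
  exact hi 0 (Nat.pos_of_ne_zero h0) (Subsingleton.elim _ _)

end InfiniteWord

theorem mainTheorem5 {A : Type*} [Finite A] (x : ℕ → A)
    (hx : (fun n : ℕ => (InfiniteWord.subwordComplexity x n : ℝ))
      =O[Filter.atTop] (fun n : ℕ => (n : ℝ))) :
    ∃ C : ℕ, ∀ n : ℕ,
      (InfiniteWord.contiguousBlocks (InfiniteWord.novelSet x n)).encard ≤ C := by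
  obtain ⟨K, hK⟩ := InfiniteWord.exists_complexity_le x hx
  obtain ⟨C, hC⟩ := InfiniteWord.exists_rightSpecial_ncard_le x hK
  refine ⟨C * Nat.card A + 1, fun n => (InfiniteWord.encard_contiguousBlocks_le _).trans ?_⟩
  rcases n with _ | n
  · refine (Set.encard_le_encard (InfiniteWord.blockStarts_novelSet_zero_subset x)).trans ?_
    rw [Set.encard_singleton]
    exact_mod_cast Nat.le_add_left 1 _
  · refine (InfiniteWord.encard_blockStarts_le x n).trans ?_
    exact_mod_cast Nat.add_le_add_right (Nat.mul_le_mul_right _ (hC n)) 1
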